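/- Let $S\in\mathbb R^{N\times N}$ be a symmetric matrix (the graph shift operator of a graph $\mathcal G$ with $N$ nodes) and let $[a,b]$, $a<b$, be an interval containing the eigenvalues of $S$. Let $\Phi$ be an $L$-layer GNN $$X^{(l)}=\sigma\Big(\sum_{k=0}^{K-1}S^kX^{(l-1)}H^{(l)}_k\Big),\qquad l=1,\dots,L,\qquad X^{(0)}=q\in\mathbb R^{N},$$ with one input feature and $F$ features at every layer, so $H_k^{(1)}\in\mathbb R^{1\times F}$ and $H_k^{(l)}\in\mathbb R^{F\times F}$ for $l\ge 2$, where $\sigma:\mathbb R\to\mathbb R$ acts entrywise, is Lipschitz with constant $C_\sigma=1$, and $\sigma(0)=0$. Write $\Phi(\mathcal G,q)=X^{(L)}$. For every layer $l$ and every pair of features $(g,f)$ consider the filter with coefficients $h_k=H^{(l)}_k[g,f]$, frequency response $h(\lambda)=\sum_{k=0}^{K-1} h_k\lambda^k$ and matrix $H(S)=\sum_{k=0}^{K-1} h_kS^k$. Suppose that every one of these filters is integral Lipschitz with one constant $C>0$ on $[a,b]$, i.e. $$|h(\lambda_2)-h(\lambda_1)|\;\frac{|\lambda_1+\lambda_2|}{2}\le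 C\,|\lambda_2-\lambda_1|\qquad\text{for all }\lambda_1,\lambda_2\in[a,b],$$ and that it satisfies $\|H(S)\|\le\beta=1/F$ in the spectral norm. For operators $A,B$ that map families $x=(x_1,\dots,x_M)$ of vectors in $\mathbb R^N$ to $\mathbb R^N$, let the distance modulo permutation be $$\|A-B\|_{\mathcal P}=\min_{\Pi}\ \max_{\|x_1\|=\dots=\|x_M\|=1}\big\|\Pi^{T}A(x_1,\dots,x_M)-B(\Pi^{T}x_1,\dots,\Pi^{T}x_M)\big\|,$$ the minimum being over the $N\times N$ permutation matrices. Then there are $\kappa\in\mathbb R$ and $\varepsilon_0>0$ such that for all $0\le\varepsilon\le\varepsilon_0$, all $E\in\mathbb R^{N\times N}$ with $\|E\|\le\varepsilon$, all $M\ge1$ and every output feature $f$, with $\tilde{\mathcal G}$ the perturbed graph with shift operator $\tilde S=S+SE+ES$, the sample-averaged positional encodings, regarded as operators on the samples $(q^{(1)},\dots,q^{(M)})$, satisfy $$\Big\|\frac1M\sum_{m=1}^M\Phi(\mathcal G,q^{(m)})[:,f]-\frac1M\sum_{m=1}^M\Phi(\tilde{\mathcal G},q^{(m)})[:,f]\Big\|_{\mathcal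 P}\le 2C\,(1+8\sqrt N)\,L\,\varepsilon+\kappa\,\varepsilon^2 .$$ -/

import Mathlib

open scoped Matrix.Norms.L2Operator ENNReal

namespace Pearl

/-- The linear action `x ↦ Πᵀ x` of the transpose of the permutation matrix of `π` on graph
signals. -/
noncomputable def permT {N : ℕ} (π : Equiv.Perm (Fin N)) (x : EuclideanSpace ℝ (Fin N)) :
    EuclideanSpace ℝ (Fin N) :=
  Matrix.toEuclideanCLM (𝕜 := ℝ) (π.permMatrix ℝ).transpose x

/-- The operator distance modulo permutation
`min_Π max_{‖x_m‖ = 1} ‖Πᵀ (A x) - B (Πᵀ x)‖`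
between two (not necessarily linear) operators `A`, `B` acting on families `x = (x_m)` of graph
signals. Operators on one signal are the case of a one-element index type. The value is taken in
`ℝ≥0∞`, so that the supremum never has a junk value; the infimum is over finitely many
permutations, hence a minimum. -/
noncomputable def permDist {N : ℕ} {ι : Type*}
    (A B : (ι → EuclideanSpace ℝ (Fin N)) → EuclideanSpace ℝ (Fin N)) : ℝ≥0∞ :=
  ⨅ π : Equiv.Perm (Fin N), ⨆ x : ι → EuclideanSpace ℝ (Fin N), ⨆ _ : ∀ m, ‖x m‖ = 1,
    ‖permT π (A x) - B (fun m => permT π (x m))‖ₑ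

/-- The graph filter `H(S) = ∑_{k<K} h_k S^k`. -/
noncomputable def graphFilter {N K : ℕ} (h : Fin K → ℝ) (S : Matrix (Fin N) (Fin N) ℝ) :
    Matrix (Fin N) (Fin N) ℝ :=
  ∑ k, h k • S ^ (k : ℕ)

/-- The frequency response `h(t) = ∑_{k<K} h_k t^k`. -/
noncomputable def freqResponse {K : ℕ} (h : Fin K → ℝ) (t : ℝ) : ℝ :=
  ∑ k, h k * t ^ (k : ℕ)

/-- The filter with coefficients `h` is integral Lipschitz with constant `C` on the set `Λ` of
frequencies: `|h(t) - h(s)| ≤ C |t - s| / (|s + t| / 2)`. The denominator is multiplied out, so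
that the inequality asks for nothing when `s + t = 0` (where the quotient is infinite). -/
def IsIntegralLipschitz {K : ℕ} (h : Fin K → ℝ) (C : ℝ) (Λ : Set ℝ) : Prop :=
  ∀ s ∈ Λ, ∀ t ∈ Λ,
    |freqResponse h t - freqResponse h s| * (|s + t| / 2) ≤ C * |t - s|

/-- The weights of a GNN with polynomial filters of `K` taps and feature dimensions
`width 0, width 1, …`: the layer from `width l` to `width (l+1)` features has the matrices
`H l k`, `k < K`. -/
abbrev Weights (width : ℕ → ℕ) (K : ℕ) : Type :=
  (l : ℕ) → Fin K → Matrix (Fin (width l)) (Fin (width (l + 1))) ℝ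

/-- The GNN recursion `X^{(l+1)} = σ (∑_{k<K} S^k X^{(l)} H_k)`, with `σ` acting entrywise.
`gnn σ H S X L` is the output after `L` layers; it uses only the weights `H l` with `l < L`. -/
noncomputable def gnn {N K : ℕ} {width : ℕ → ℕ} (σ : ℝ → ℝ) (H : Weights width K)
    (S : Matrix (Fin N) (Fin N) ℝ) (X : Matrix (Fin N) (Fin (width 0)) ℝ) :
    (L : ℕ) → Matrix (Fin N) (Fin (width L)) ℝ
  | 0 => X
  | l + 1 => (∑ k : Fin K, S ^ (k : ℕ) * gnn σ H S X l * H l k).map σ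

/-- One input feature, and `F` features at every layer. -/
def pearlWidth (F : ℕ) : ℕ → ℕ
  | 0 => 1
  | _ + 1 => F

/-- A graph signal as a feature matrix with one column. -/
def asColumn {N F : ℕ} (q : EuclideanSpace ℝ (Fin N)) :
    Matrix (Fin N) (Fin (pearlWidth F 0)) ℝ :=
  Matrix.of fun i _ => q i

/-- The column `Φ(G, q)[:, f]` of the output of the `L`-layer GNN on the graph with shift operator
`S` and the initial node attributes `q`. -/
noncomputable def pearlColumn {N K F : ℕ} (σ : ℝ → ℝ) (H : Weights (pearlWidth F) K) (L : ℕ)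
    (f : Fin (pearlWidth F L)) (S : Matrix (Fin N) (Fin N) ℝ) (q : EuclideanSpace ℝ (Fin N)) :
    EuclideanSpace ℝ (Fin N) :=
  WithLp.toLp 2 fun i => gnn σ H S (asColumn q) L i f

/-- The sample-averaged positional encoding `(1/M) ∑_{m<M} Φ(G, q^{(m)})[:, f]`, as an operator on
the family `q` of samples. -/
noncomputable def averagedPE {N K F M : ℕ} (σ : ℝ → ℝ) (H : Weights (pearlWidth F) K) (L : ℕ)
    (f : Fin (pearlWidth F L)) (S : Matrix (Fin N) (Fin N) ℝ)
    (q : Fin M → EuclideanSpace ℝ (Fin N)) : EuclideanSpace ℝ (Fin N) :=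
  (1 / (M : ℝ)) • ∑ m, pearlColumn σ H L f S (q m)

end Pearl

/-!
In an orthonormal eigenbasis of `S`, with eigenvalues `λ`, the derivative at `S` of a graph filter
`S ↦ H(S)` multiplies the `(i, j)` entry of a perturbation by the divided difference
`h[λ i, λ j]` of the frequency response (Daleckii–Krein). The relative perturbation `SE + ES` has
the entries `(λ i + λ j) E i j`, and the integral Lipschitz condition is exactly a bound of
`h[λ i, λ j] (λ i + λ j)` by `2C`. An entrywise bound costs a factor `√N` in the spectral norm, so
each filter moves by at most `2C√N ‖E‖ + O(‖E‖²)`.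

If every filter moves by at most `Δ`, the normalization `‖H(S)‖ ≤ 1/F` makes the error `e l` of a
feature after `l` layers satisfy `e (l + 1) ≤ Δ + (1 + FΔ) e l`. Hence `e L ≤ Δ ∑_{i<L} (1 + FΔ)^i`,
which is `LΔ + O(Δ²)`.
-/

namespace Pearl

open Asymptotics Filter Matrix Topology

theorem isBigO_sub_sub_fderiv_of_analyticAt {𝕜 V W : Type*} [NontriviallyNormedField 𝕜]
    [NormedAddCommGroup V] [NormedSpace 𝕜 V] [NormedAddCommGroup W] [NormedSpace 𝕜 W]
    {f : V → W} {x : V} (hf : AnalyticAt 𝕜 f x) :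
    (fun y => f (x + y) - f x - fderiv 𝕜 f x y) =O[𝓝 0] fun y => ‖y‖ ^ 2 := by
  obtain ⟨p, hp⟩ := hf
  refine (hp.isBigO_sub_partialSum_pow 2).congr_left fun y => ?_
  rw [FormalMultilinearSeries.partialSum, Finset.sum_range_succ, Finset.sum_range_one,
    hp.coeff_zero, hp.fderiv_eq, continuousMultilinearCurryFin1_apply, ← sub_sub]
  congr 2

theorem isBigO_mul_geom_sum_sub (B κ c : ℝ) (L : ℕ) :
    (fun t : ℝ => (B * t + κ * t ^ 2) *
      (∑ i ∈ Finset.range L, (1 + c * (B * t + κ * t ^ 2)) ^ i) - L * B * t) =O[𝓝 0]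
        fun t => t ^ 2 := by
  let δ : ℝ → ℝ := fun t => B * t + κ * t ^ 2
  let G : ℝ → ℝ := fun t => ∑ i ∈ Finset.range L, (1 + c * δ t) ^ i
  have hδ : HasDerivAt δ B 0 := by
    simpa using! ((hasDerivAt_id (0 : ℝ)).const_mul B).add
      ((hasDerivAt_pow 2 (0 : ℝ)).const_mul κ)
  have hG : DifferentiableAt ℝ G 0 := by fun_prop
  have hfderiv (t : ℝ) : fderiv ℝ (fun t => δ t * G t) 0 t = L * B * t := by
    rw [(hδ.fun_mul hG.hasDerivAt).hasFDerivAt.fderiv]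
    simp [δ, G, mul_comm, mul_left_comm]
  have hanalytic : AnalyticAt ℝ (fun t => δ t * G t) 0 := by
    fun_prop
  refine (isBigO_sub_sub_fderiv_of_analyticAt hanalytic).norm_right.congr (fun t => ?_) fun t => ?_
  · rw [hfderiv]
    simp [δ, G]
  · simp

section EntrywiseBounds

variable {𝕜 m n : Type*} [RCLike 𝕜] [Fintype m] [Fintype n] [DecidableEq n]

theorem l2_opNorm_sq_le_sum_norm_sq (A : Matrix m n 𝕜) : ‖A‖ ^ 2 ≤ ∑ i, ∑ j, ‖A i j‖ ^ 2 := by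
  have hnonneg : 0 ≤ ∑ i, ∑ j, ‖A i j‖ ^ 2 := by positivity
  rw [← Real.le_sqrt (norm_nonneg _) hnonneg, l2_opNorm_def]
  refine ContinuousLinearMap.opNorm_le_bound _ (Real.sqrt_nonneg _) fun x => ?_
  rw [EuclideanSpace.norm_eq, EuclideanSpace.norm_eq, ← Real.sqrt_mul hnonneg, Finset.sum_mul]
  refine Real.sqrt_le_sqrt (Finset.sum_le_sum fun i _ => ?_)
  calc ‖∑ j, A i j * x j‖ ^ 2 ≤ (∑ j, ‖A i j‖ * ‖x j‖) ^ 2 := by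
        gcongr
        exact norm_sum_le_of_le _ fun j _ => norm_mul_le _ _
    _ ≤ (∑ j, ‖A i j‖ ^ 2) * ∑ j, ‖x j‖ ^ 2 := Finset.sum_mul_sq_le_sq_mul_sq _ _ _

theorem sum_norm_sq_le_card_mul_l2_opNorm_sq (A : Matrix m n 𝕜) :
    ∑ i, ∑ j, ‖A i j‖ ^ 2 ≤ Fintype.card n * ‖A‖ ^ 2 := by
  have hcol (j : n) : ∑ i, ‖A i j‖ ^ 2 ≤ ‖A‖ ^ 2 := by
    have h := l2_opNorm_mulVec A (EuclideanSpace.single j 1)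
    rw [PiLp.norm_single, norm_one, mul_one, EuclideanSpace.norm_eq,
      Real.sqrt_le_left (norm_nonneg _)] at h
    simpa using h
  rw [Finset.sum_comm, ← nsmul_eq_mul]
  exact Finset.sum_le_card_nsmul _ _ _ fun j _ => hcol j

theorem l2_opNorm_le_of_forall_norm_le {c : ℝ} (hc : 0 ≤ c) {A B : Matrix m n 𝕜}
    (h : ∀ i j, ‖A i j‖ ≤ c * ‖B i j‖) : ‖A‖ ≤ c * √(Fintype.card n) * ‖B‖ := by
  refine (sq_le_sq₀ (norm_nonneg _) (by positivity)).1 ?_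
  calc ‖A‖ ^ 2 ≤ ∑ i, ∑ j, ‖A i j‖ ^ 2 := l2_opNorm_sq_le_sum_norm_sq A
    _ ≤ ∑ i, ∑ j, (c * ‖B i j‖) ^ 2 := by gcongr; exact h _ _
    _ = c ^ 2 * ∑ i, ∑ j, ‖B i j‖ ^ 2 := by simp only [mul_pow, Finset.mul_sum]
    _ ≤ c ^ 2 * (Fintype.card n * ‖B‖ ^ 2) := by
        gcongr
        exact sum_norm_sq_le_card_mul_l2_opNorm_sq B
    _ = (c * √(Fintype.card n) * ‖B‖) ^ 2 := by
        rw [mul_pow, mul_pow, Real.sq_sqrt (Nat.cast_nonneg _), mul_assoc]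

end EntrywiseBounds

section DividedDifference

variable {K : ℕ}

/-- The divided difference `h[x, y]` of the frequency response with coefficients `h`, written as
the polynomial `∑_{k<K} h_k ∑_{i<k} x^{k-1-i} y^i`, so that `h[x, x]` is the derivative at `x`. -/
def divDiff (h : Fin K → ℝ) (x y : ℝ) : ℝ :=
  ∑ k : Fin K, h k * ∑ i ∈ Finset.range k, x ^ ((k : ℕ) - 1 - i) * y ^ i

theorem divDiff_mul_sub (h : Fin K → ℝ) (x y : ℝ) :
    divDiff h x y * (y - x) = freqResponse h y - freqResponse h x := by
  simp only [divDiff, freqResponse, Finset.sum_mul, ← Finset.sum_sub_distrib, ← mul_sub,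
    mul_assoc, ← (Commute.all y x).geom_sum₂_mul, mul_comm (y ^ _)]

theorem continuous_divDiff (h : Fin K → ℝ) (x : ℝ) : Continuous (divDiff h x) := by
  unfold divDiff
  fun_prop

theorem IsIntegralLipschitz.abs_divDiff_mul_add_le {h : Fin K → ℝ} {C : ℝ} {Λ : Set ℝ}
    (hΛ : IsPreconnected Λ) (hΛ' : Λ.Nontrivial) (hh : IsIntegralLipschitz h C Λ) {x y : ℝ}
    (hx : x ∈ Λ) (hy : y ∈ Λ) : |divDiff h x y * (x + y)| ≤ 2 * C := by
  have hoff : ∀ z ∈ Λ, z ≠ x → |divDiff h x z * (x + z)| ≤ 2 * C := by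
    intro z hz hzx
    have hpos : 0 < |z - x| := abs_pos.2 (sub_ne_zero.2 hzx)
    have hbound := hh x hx z hz
    rw [← divDiff_mul_sub, abs_mul] at hbound
    rw [abs_mul]
    refine le_of_mul_le_mul_right ?_ hpos
    linarith
  obtain rfl | hne := eq_or_ne y x
  · -- The diagonal value is the limit of the values off the diagonal.
    have hcont : Continuous fun z => |divDiff h y z * (y + z)| :=
      ((continuous_divDiff h y).mul (continuous_const.add continuous_id)).abs
    have : (𝓝[Λ \ {y}] y).NeBot :=
      accPt_principal_iff_nhdsWithin.1 (hΛ.preperfect_of_nontrivial hΛ' y hy)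
    have hlim : Tendsto (fun z => |divDiff h y z * (y + z)|) (𝓝[Λ \ {y}] y)
        (𝓝 |divDiff h y y * (y + y)|) := (hcont.tendsto y).mono_left nhdsWithin_le_nhds
    exact le_of_tendsto hlim (eventually_nhdsWithin_of_forall fun z hz => hoff z hz.1 hz.2)
  · exact hoff y hy hne

end DividedDifference

section GraphFilter

variable {N K : ℕ} {h : Fin K → ℝ} {S : Matrix (Fin N) (Fin N) ℝ}

theorem analyticAt_graphFilter : AnalyticAt ℝ (graphFilter h) S := by
  unfold graphFilter
  fun_prop

theorem fderiv_graphFilter_apply (h : Fin K → ℝ) (S T : Matrix (Fin N) (Fin N) ℝ) :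
    fderiv ℝ (graphFilter h) S T =
      ∑ k : Fin K, h k • ∑ i ∈ Finset.range k, S ^ ((k : ℕ) - 1 - i) * T * S ^ i := by
  have hderiv := HasFDerivAt.fun_sum (u := Finset.univ) fun (k : Fin K) _ =>
    (hasFDerivAt_pow' (𝕜 := ℝ) (k : ℕ) (x := S)).const_smul (h k)
  rw [HasFDerivAt.fderiv (f := graphFilter h) hderiv]
  simp [mul_assoc]

theorem map_fderiv_graphFilter {Φ : Type*}
    [FunLike Φ (Matrix (Fin N) (Fin N) ℝ) (Matrix (Fin N) (Fin N) ℝ)]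
    [AlgHomClass Φ ℝ (Matrix (Fin N) (Fin N) ℝ) (Matrix (Fin N) (Fin N) ℝ)] (φ : Φ)
    (h : Fin K → ℝ) (S T : Matrix (Fin N) (Fin N) ℝ) :
    φ (fderiv ℝ (graphFilter h) S T) = fderiv ℝ (graphFilter h) (φ S) (φ T) := by
  simp only [fderiv_graphFilter_apply, map_sum, map_smul, map_mul, map_pow]

theorem fderiv_graphFilter_diagonal_apply (h : Fin K → ℝ) (d : Fin N → ℝ)
    (T : Matrix (Fin N) (Fin N) ℝ) (i j : Fin N) :
    fderiv ℝ (graphFilter h) (diagonal d) T i j = divDiff h (d i) (d j) * T i j := by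
  simp only [fderiv_graphFilter_apply, divDiff, Matrix.sum_apply, Matrix.smul_apply,
    diagonal_pow, mul_diagonal, diagonal_mul, Pi.pow_apply, smul_eq_mul, Finset.sum_mul, mul_assoc,
    mul_comm (T i j)]

theorem norm_conjStarAlgAut {𝕜 R : Type*} [CommSemiring 𝕜] [NormedRing R] [StarRing R]
    [CStarRing R] [Algebra 𝕜 R] (U : unitary R) (A : R) :
    ‖Unitary.conjStarAlgAut 𝕜 R U A‖ = ‖A‖ := by
  rw [Unitary.conjStarAlgAut_apply, ← Unitary.coe_star, CStarRing.norm_mul_coe_unitary,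
    CStarRing.norm_coe_unitary_mul]

theorem norm_fderiv_graphFilter_relative_le (hS : S.IsSymm) {a b C : ℝ} (hab : a < b)
    (hspec : spectrum ℝ S ⊆ Set.Icc a b) (hh : IsIntegralLipschitz h C (Set.Icc a b))
    (E : Matrix (Fin N) (Fin N) ℝ) :
    ‖fderiv ℝ (graphFilter h) S (S * E + E * S)‖ ≤ 2 * C * √N * ‖E‖ := by
  have ha : a ∈ Set.Icc a b := Set.left_mem_Icc.2 hab.le
  have hnontrivial : (Set.Icc a b).Nontrivial := ⟨a, ha, b, Set.right_mem_Icc.2 hab.le, hab.ne⟩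
  have hdiff {x y : ℝ} (hx : x ∈ Set.Icc a b) (hy : y ∈ Set.Icc a b) :
      |divDiff h x y * (x + y)| ≤ 2 * C :=
    hh.abs_divDiff_mul_add_le isPreconnected_Icc hnontrivial hx hy
  have hC : 0 ≤ 2 * C := (abs_nonneg _).trans (hdiff ha ha)
  have hherm : S.IsHermitian := (conjTranspose_eq_transpose_of_trivial S).trans hS
  let d := hherm.eigenvalues
  have hd (i : Fin N) : d i ∈ Set.Icc a b := hspec (hherm.eigenvalues_mem_spectrum_real i)
  let φ := Unitary.conjStarAlgAut ℝ (Matrix (Fin N) (Fin N) ℝ) (star hherm.eigenvectorUnitary)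
  have hφS : φ S = diagonal d := hherm.conjStarAlgAut_star_eigenvectorUnitary
  have hentry (i j : Fin N) : φ (fderiv ℝ (graphFilter h) S (S * E + E * S)) i j =
      divDiff h (d i) (d j) * (d i + d j) * φ E i j := by
    rw [map_fderiv_graphFilter, map_add, map_mul, map_mul, hφS, fderiv_graphFilter_diagonal_apply,
      Matrix.add_apply, diagonal_mul, mul_diagonal]
    ring
  rw [← norm_conjStarAlgAut (𝕜 := ℝ) (star hherm.eigenvectorUnitary),
    ← norm_conjStarAlgAut (𝕜 := ℝ) (star hherm.eigenvectorUnitary) E]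
  refine (l2_opNorm_le_of_forall_norm_le hC fun i j => ?_).trans_eq (by rw [Fintype.card_fin])
  rw [hentry, norm_mul]
  gcongr
  exact hdiff (hd i) (hd j)

theorem isBigO_graphFilter_relative_sub_fderiv (h : Fin K → ℝ) (S : Matrix (Fin N) (Fin N) ℝ) :
    (fun E => graphFilter h (S + S * E + E * S) - graphFilter h S -
      fderiv ℝ (graphFilter h) S (S * E + E * S)) =O[𝓝 0] fun E => ‖E‖ ^ 2 := by
  have hlim : Tendsto (fun E => S * E + E * S) (𝓝 0) (𝓝 0) :=
    Continuous.tendsto' (by fun_prop) _ _ (by simp)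
  have hlin : (fun E => S * E + E * S) =O[𝓝 0] fun E => E :=
    (isBigO_const_mul_self S id _).add
      (IsBigO.of_bound ‖S‖ (.of_forall fun E => (norm_mul_le E S).trans_eq (mul_comm _ _)))
  simpa only [Function.comp_def, ← add_assoc] using
    ((isBigO_sub_sub_fderiv_of_analyticAt analyticAt_graphFilter).comp_tendsto hlim).trans
      (hlin.norm_norm.pow 2)

theorem eventually_norm_graphFilter_relative_sub_le (hS : S.IsSymm) {a b C : ℝ} (hab : a < b)
    (hspec : spectrum ℝ S ⊆ Set.Icc a b) (hh : IsIntegralLipschitz h C (Set.Icc a b)) :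
    ∀ᶠ κ in atTop, ∀ᶠ E in 𝓝 (0 : Matrix (Fin N) (Fin N) ℝ),
      ‖graphFilter h (S + S * E + E * S) - graphFilter h S‖ ≤
        2 * C * √N * ‖E‖ + κ * ‖E‖ ^ 2 := by
  filter_upwards [isBigO_iff_eventually.1 (isBigO_graphFilter_relative_sub_fderiv h S)] with κ hκ
  filter_upwards [hκ] with E hE
  rw [norm_pow, norm_norm] at hE
  exact (norm_le_norm_add_norm_sub' _ _).trans
    (add_le_add (norm_fderiv_graphFilter_relative_le hS hab hspec hh E) hE)

end GraphFilter

section Layer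

variable {ι V W : Type*} [Fintype ι] [NormedAddCommGroup V] [NormedSpace ℝ V]
  [NormedAddCommGroup W] [NormedSpace ℝ W] {s : W → W} {A A' : ι → V →L[ℝ] W} {β Δ : ℝ}

theorem norm_layer_le (hs : LipschitzWith 1 s) (hs0 : s 0 = 0) (hA : ∀ g, ‖A g‖ ≤ β)
    (x : ι → V) : ‖s (∑ g, A g (x g))‖ ≤ β * ∑ g, ‖x g‖ := by
  have h := hs.norm_le_mul hs0 (∑ g, A g (x g))
  rw [NNReal.coe_one, one_mul] at h
  refine h.trans ?_
  rw [Finset.mul_sum]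
  exact norm_sum_le_of_le _ fun g _ => (A g).le_of_opNorm_le (hA g) (x g)

theorem norm_layer_sub_layer_le (hs : LipschitzWith 1 s) (hA : ∀ g, ‖A g‖ ≤ β)
    (hAA' : ∀ g, ‖A' g - A g‖ ≤ Δ) (x x' : ι → V) :
    ‖s (∑ g, A g (x g)) - s (∑ g, A' g (x' g))‖ ≤
      Δ * ∑ g, ‖x g‖ + (β + Δ) * ∑ g, ‖x g - x' g‖ := by
  have hA' (g : ι) : ‖A' g‖ ≤ β + Δ :=
    (norm_le_norm_add_norm_sub' (A' g) (A g)).trans (add_le_add (hA g) (hAA' g))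
  have hterm (g : ι) : ‖A g (x g) - A' g (x' g)‖ ≤ Δ * ‖x g‖ + (β + Δ) * ‖x g - x' g‖ := by
    have hsplit : A g (x g) - A' g (x' g) = A' g (x g - x' g) - (A' g - A g) (x g) := by
      rw [map_sub, _root_.sub_apply]
      abel
    rw [hsplit, add_comm]
    exact norm_sub_le_of_le ((A' g).le_of_opNorm_le (hA' g) _)
      ((A' g - A g).le_of_opNorm_le (hAA' g) _)
  have hlip := hs.norm_sub_le (∑ g, A g (x g)) (∑ g, A' g (x' g))
  rw [NNReal.coe_one, one_mul] at hlip
  refine hlip.trans ?_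
  rw [← Finset.sum_sub_distrib, Finset.mul_sum, Finset.mul_sum, ← Finset.sum_add_distrib]
  exact norm_sum_le_of_le _ fun g _ => hterm g

end Layer

section Entrywise

variable {ι : Type*}

/-- The entrywise application of an activation function `σ` to a vector of Euclidean space. -/
def entrywise (σ : ℝ → ℝ) (u : EuclideanSpace ℝ ι) : EuclideanSpace ℝ ι :=
  WithLp.toLp 2 fun i => σ (u i)

theorem lipschitzWith_entrywise [Fintype ι] {σ : ℝ → ℝ} {c : NNReal} (hσ : LipschitzWith c σ) :
    LipschitzWith c (entrywise σ : EuclideanSpace ℝ ι → EuclideanSpace ℝ ι) := by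
  refine LipschitzWith.of_dist_le_mul fun u v => ?_
  rw [EuclideanSpace.dist_eq, EuclideanSpace.dist_eq, ← Real.sqrt_sq c.coe_nonneg,
    ← Real.sqrt_mul (sq_nonneg _), Finset.mul_sum]
  refine Real.sqrt_le_sqrt (Finset.sum_le_sum fun i _ => ?_)
  rw [← mul_pow]
  exact pow_le_pow_left₀ dist_nonneg (hσ.dist_le_mul (u i) (v i)) 2

theorem entrywise_zero {σ : ℝ → ℝ} (hσ0 : σ 0 = 0) :
    entrywise σ (0 : EuclideanSpace ℝ ι) = 0 := by
  ext
  exact hσ0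

end Entrywise

section PearlColumn

variable {N K F : ℕ} {σ : ℝ → ℝ} {H : Weights (pearlWidth F) K} {S S' : Matrix (Fin N) (Fin N) ℝ}

theorem pearlColumn_zero (f : Fin (pearlWidth F 0)) (q : EuclideanSpace ℝ (Fin N)) :
    pearlColumn σ H 0 f S q = q := rfl

theorem pearlColumn_succ (l : ℕ) (f : Fin (pearlWidth F (l + 1))) (q : EuclideanSpace ℝ (Fin N)) :
    pearlColumn σ H (l + 1) f S q = entrywise σ (∑ g,
      toEuclideanCLM (𝕜 := ℝ) (graphFilter (fun k => H l k g f) S) (pearlColumn σ H l g S q)) := by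
  ext i
  simp only [pearlColumn, entrywise, gnn, map_apply, Matrix.sum_apply, mul_apply,
    WithLp.ofLp_sum, Finset.sum_apply, toEuclideanCLM_toLp, graphFilter, mulVec,
    dotProduct, Matrix.smul_apply, smul_eq_mul, Finset.sum_mul]
  rw [Finset.sum_comm]
  refine congrArg σ (Finset.sum_congr rfl fun g _ => ?_)
  rw [Finset.sum_comm]
  refine Finset.sum_congr rfl fun k _ => Finset.sum_congr rfl fun j _ => ?_
  ring

theorem sum_fin_pearlWidth_zero (x : Fin (pearlWidth F 0) → ℝ) : ∑ g, x g = x (0 : Fin 1) :=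
  Fin.sum_univ_one x

theorem sum_fin_pearlWidth_succ_le {l : ℕ} {x : Fin (pearlWidth F (l + 1)) → ℝ} {c : ℝ}
    (hx : ∀ f, x f ≤ c) : ∑ f, x f ≤ F * c := by
  have h := Finset.sum_le_card_nsmul Finset.univ x c fun f _ => hx f
  rwa [Finset.card_univ, Fintype.card_fin, nsmul_eq_mul] at h

theorem sum_norm_pearlColumn_le (hσ : LipschitzWith 1 σ) (hσ0 : σ 0 = 0) {L : ℕ}
    (hβ : ∀ l < L, ∀ g f, ‖graphFilter (fun k => H l k g f) S‖ ≤ 1 / (F : ℝ))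
    (q : EuclideanSpace ℝ (Fin N)) : ∑ g, ‖pearlColumn σ H L g S q‖ ≤ ‖q‖ := by
  have hF : (F : ℝ) * (1 / F) ≤ 1 := by rw [one_div]; exact mul_inv_le_one
  induction L with
  | zero => simp only [sum_fin_pearlWidth_zero, pearlColumn_zero, le_refl]
  | succ l ih =>
    have hcol (f : Fin (pearlWidth F (l + 1))) :
        ‖pearlColumn σ H (l + 1) f S q‖ ≤ 1 / (F : ℝ) * ‖q‖ := by
      rw [pearlColumn_succ]
      refine (norm_layer_le (lipschitzWith_entrywise hσ) (entrywise_zero hσ0)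
        (A := fun g => toEuclideanCLM (𝕜 := ℝ) (graphFilter (fun k => H l k g f) S))
        (fun g => (l2_opNorm_toEuclideanCLM _).trans_le (hβ l l.lt_succ_self g f)) _).trans ?_
      gcongr
      exact ih fun i hi => hβ i (hi.trans l.lt_succ_self)
    calc ∑ f, ‖pearlColumn σ H (l + 1) f S q‖ ≤ F * (1 / F * ‖q‖) :=
          sum_fin_pearlWidth_succ_le hcol
      _ ≤ ‖q‖ := by
          rw [← mul_assoc]
          exact mul_le_of_le_one_left (norm_nonneg q) hF

theorem norm_pearlColumn_sub_le (hσ : LipschitzWith 1 σ) (hσ0 : σ 0 = 0) {L : ℕ}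
    (hβ : ∀ l < L, ∀ g f, ‖graphFilter (fun k => H l k g f) S‖ ≤ 1 / (F : ℝ))
    {Δ : ℝ} (hΔ : 0 ≤ Δ) (hSS' : ∀ l < L, ∀ g f,
      ‖graphFilter (fun k => H l k g f) S' - graphFilter (fun k => H l k g f) S‖ ≤ Δ)
    (f : Fin (pearlWidth F L)) (q : EuclideanSpace ℝ (Fin N)) :
    ‖pearlColumn σ H L f S q - pearlColumn σ H L f S' q‖ ≤
      Δ * (∑ i ∈ Finset.range L, (1 + F * Δ) ^ i) * ‖q‖ := by
  have hF : (F : ℝ) * (1 / F) ≤ 1 := by rw [one_div]; exact mul_inv_le_one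
  induction L with
  | zero => simp [pearlColumn_zero]
  | succ l ih =>
    have hβ' : ∀ i < l, ∀ g f, ‖graphFilter (fun k => H i k g f) S‖ ≤ 1 / (F : ℝ) :=
      fun i hi => hβ i (hi.trans l.lt_succ_self)
    have ih := ih hβ' fun i hi => hSS' i (hi.trans l.lt_succ_self)
    set G := ∑ i ∈ Finset.range l, (1 + F * Δ) ^ i
    have hsum : ∑ g, ‖pearlColumn σ H l g S q - pearlColumn σ H l g S' q‖ ≤
        F * (Δ * G * ‖q‖) := by
      cases l with
      | zero => simp [pearlColumn_zero, G]
      | succ l => exact sum_fin_pearlWidth_succ_le ih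
    have hlayer := norm_layer_sub_layer_le (lipschitzWith_entrywise hσ)
      (A := fun g => toEuclideanCLM (𝕜 := ℝ) (graphFilter (fun k => H l k g f) S))
      (A' := fun g => toEuclideanCLM (𝕜 := ℝ) (graphFilter (fun k => H l k g f) S'))
      (fun g => (l2_opNorm_toEuclideanCLM _).trans_le (hβ l l.lt_succ_self g f))
      (fun g => by
        rw [← map_sub, l2_opNorm_toEuclideanCLM]
        exact hSS' l l.lt_succ_self g f)
      (fun g => pearlColumn σ H l g S q) (fun g => pearlColumn σ H l g S' q)
    rw [pearlColumn_succ, pearlColumn_succ, geom_sum_succ]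
    calc _ ≤ Δ * ‖q‖ + (1 / F + Δ) * (F * (Δ * G * ‖q‖)) := by
          refine hlayer.trans ?_
          gcongr
          exact sum_norm_pearlColumn_le hσ hσ0 hβ' q
      _ = Δ * ‖q‖ + (F * (1 / F) + F * Δ) * (Δ * G * ‖q‖) := by ring
      _ ≤ Δ * ‖q‖ + (1 + F * Δ) * (Δ * G * ‖q‖) := by
          gcongr
      _ = Δ * ((1 + F * Δ) * G + 1) * ‖q‖ := by ring

theorem eventually_norm_pearlColumn_sub_le (hσ : LipschitzWith 1 σ) (hσ0 : σ 0 = 0) {L : ℕ}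
    (hβ : ∀ l < L, ∀ g f, ‖graphFilter (fun k => H l k g f) S‖ ≤ 1 / (F : ℝ))
    {V : Type*} [SeminormedAddCommGroup V] {P : V → Matrix (Fin N) (Fin N) ℝ} {B : ℝ} (hB : 0 ≤ B)
    (hP : ∀ l < L, ∀ g f, ∀ᶠ κ in atTop, ∀ᶠ E in 𝓝 0,
      ‖graphFilter (fun k => H l k g f) (P E) - graphFilter (fun k => H l k g f) S‖ ≤
        B * ‖E‖ + κ * ‖E‖ ^ 2) :
    ∀ᶠ κ in atTop, ∀ᶠ E in 𝓝 0, ∀ f q,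
      ‖pearlColumn σ H L f S q - pearlColumn σ H L f (P E) q‖ ≤
        (L * B * ‖E‖ + κ * ‖E‖ ^ 2) * ‖q‖ := by
  obtain ⟨κ, hκ, hκ0⟩ := (((Set.finite_Iio L).eventually_all.2 fun l hl =>
    eventually_all.2 fun g => eventually_all.2 (hP l hl g)).and (eventually_ge_atTop 0)).exists
  replace hκ := (Set.finite_Iio L).eventually_all.2 fun l hl =>
    eventually_all.2 fun g => eventually_all.2 (hκ l hl g)
  have hgeom := (isBigO_mul_geom_sum_sub B κ F L).comp_tendsto (tendsto_norm_zero (E := V))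
  filter_upwards [isBigO_iff_eventually.1 hgeom] with κ' hκ'
  filter_upwards [hκ, hκ'] with E hE hE' f q
  refine (norm_pearlColumn_sub_le hσ hσ0 hβ (by positivity) hE f q).trans ?_
  gcongr
  have := (le_abs_self _).trans hE'
  simp only [Function.comp_apply, norm_pow, norm_norm] at this
  linarith

end PearlColumn

theorem norm_averagedPE_sub_le {N K F M L : ℕ} {σ : ℝ → ℝ} {H : Weights (pearlWidth F) K}
    {S S' : Matrix (Fin N) (Fin N) ℝ} {f : Fin (pearlWidth F L)}
    {q : Fin M → EuclideanSpace ℝ (Fin N)} {D : ℝ} (hM : 1 ≤ M)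
    (h : ∀ m, ‖pearlColumn σ H L f S (q m) - pearlColumn σ H L f S' (q m)‖ ≤ D) :
    ‖averagedPE σ H L f S q - averagedPE σ H L f S' q‖ ≤ D := by
  have hM' : (0 : ℝ) < M := by exact_mod_cast hM
  rw [averagedPE, averagedPE, ← smul_sub, ← Finset.sum_sub_distrib, norm_smul,
    Real.norm_of_nonneg (by positivity), one_div, inv_mul_le_iff₀ hM']
  simpa using norm_sum_le_of_le Finset.univ fun m _ => h m

theorem permT_one {N : ℕ} (x : EuclideanSpace ℝ (Fin N)) : permT 1 x = x := by
  simp [permT]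

theorem permDist_le_ofReal {N : ℕ} {ι : Type*}
    {A B : (ι → EuclideanSpace ℝ (Fin N)) → EuclideanSpace ℝ (Fin N)} {r : ℝ}
    (h : ∀ x, (∀ m, ‖x m‖ = 1) → ‖A x - B x‖ ≤ r) : permDist A B ≤ ENNReal.ofReal r := by
  refine (iInf_le _ 1).trans (iSup₂_le fun x hx => ?_)
  simp only [permT_one]
  rw [← ofReal_norm]
  exact ENNReal.ofReal_le_ofReal (h x hx)

end Pearl

theorem mainTheorem8_general (N K F L : ℕ)
    (S : Matrix (Fin N) (Fin N) ℝ) (hS : S.IsSymm)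
    (a b : ℝ) (hab : a < b) (hspec : spectrum ℝ S ⊆ Set.Icc a b)
    (σ : ℝ → ℝ) (hσ : LipschitzWith 1 σ) (hσ0 : σ 0 = 0)
    (H : Pearl.Weights (Pearl.pearlWidth F) K)
    (C : ℝ) (hC : 0 ≤ C)
    (hIL : ∀ l < L, ∀ g f, Pearl.IsIntegralLipschitz (fun k => H l k g f) C (Set.Icc a b))
    (hβ : ∀ l < L, ∀ g f, ‖Pearl.graphFilter (fun k => H l k g f) S‖ ≤ 1 / (F : ℝ)) :
    ∃ κ ε₀ : ℝ, 0 < ε₀ ∧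
      ∀ ε : ℝ, ε ≤ ε₀ →
      ∀ E : Matrix (Fin N) (Fin N) ℝ, ‖E‖ ≤ ε →
      ∀ (M : ℕ), 1 ≤ M → ∀ f : Fin (Pearl.pearlWidth F L),
        Pearl.permDist
            (Pearl.averagedPE (M := M) σ H L f S)
            (Pearl.averagedPE (M := M) σ H L f (S + S * E + E * S))
          ≤ ENNReal.ofReal (2 * C * √(N : ℝ) * L * ε + κ * ε ^ 2) := by
  have hfilter := fun l hl g f =>
    Pearl.eventually_norm_graphFilter_relative_sub_le hS hab hspec (hIL l hl g f)
  obtain ⟨κ, hκ, hκ0⟩ := ((Pearl.eventually_norm_pearlColumn_sub_le hσ hσ0 hβ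
    (by positivity) hfilter).and (Filter.eventually_ge_atTop 0)).exists
  obtain ⟨r, hr, hball⟩ := Metric.eventually_nhds_iff_ball.1 hκ
  refine ⟨κ, r / 2, half_pos hr, fun ε hε E hE M hM f => Pearl.permDist_le_ofReal fun q hq =>
    Pearl.norm_averagedPE_sub_le hM fun m => ?_⟩
  have hEr : E ∈ Metric.ball 0 r := mem_ball_zero_iff.2 (by linarith)
  calc _ ≤ (L * (2 * C * √N) * ‖E‖ + κ * ‖E‖ ^ 2) * ‖q m‖ := hball E hEr f (q m)
    _ = 2 * C * √N * L * ‖E‖ + κ * ‖E‖ ^ 2 := by rw [hq m]; ring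
    _ ≤ 2 * C * √N * L * ε + κ * ε ^ 2 := by gcongr

theorem mainTheorem8 (N K F L : ℕ)
    (S : Matrix (Fin N) (Fin N) ℝ) (hS : S.IsSymm)
    (a b : ℝ) (hab : a < b) (hspec : spectrum ℝ S ⊆ Set.Icc a b)
    (σ : ℝ → ℝ) (hσ : LipschitzWith 1 σ) (hσ0 : σ 0 = 0)
    (H : Pearl.Weights (Pearl.pearlWidth F) K)
    (C : ℝ) (hC : 0 < C)
    (hIL : ∀ l < L, ∀ g f, Pearl.IsIntegralLipschitz (fun k => H l k g f) C (Set.Icc a b))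
    (hβ : ∀ l < L, ∀ g f, ‖Pearl.graphFilter (fun k => H l k g f) S‖ ≤ 1 / (F : ℝ)) :
    ∃ κ ε₀ : ℝ, 0 < ε₀ ∧
      ∀ ε : ℝ, 0 ≤ ε → ε ≤ ε₀ →
      ∀ E : Matrix (Fin N) (Fin N) ℝ, ‖E‖ ≤ ε →
      ∀ (M : ℕ), 1 ≤ M → ∀ f : Fin (Pearl.pearlWidth F L),
        Pearl.permDist
            (Pearl.averagedPE (M := M) σ H L f S)
            (Pearl.averagedPE (M := M) σ H L f (S + S * E + E * S))
          ≤ ENNReal.ofReal (2 * C * (1 + 8 * √(N : ℝ)) * L * ε + κ * ε ^ 2) := by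
  obtain ⟨κ, ε₀, hε₀, h⟩ :=
    mainTheorem8_general N K F L S hS a b hab hspec σ hσ hσ0 H C hC.le hIL hβ
  refine ⟨κ, ε₀, hε₀, fun ε hε hεε₀ E hE M hM f =>
    (h ε hεε₀ E hE M hM f).trans (ENNReal.ofReal_le_ofReal ?_)⟩
  gcongr
  linarith [Real.sqrt_nonneg N]
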